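/- Let $G$ be a finite group and let $\operatorname{Irr} G$ be the set of its irreducible complex characters. For $X\subseteq\operatorname{Irr}G$ put $\sigma_X=\sum_{\chi\in X}\chi(1)\chi$, and for $K\subseteq G$ put $\hat K=\sum_{g\in K}g\in\mathbb{C}G$. Characters are extended linearly to $\mathbb{C}G$. For a set $\mathcal{X}$ of subsets of $\operatorname{Irr}G$, let $\operatorname{Clpt}(\mathcal{X})$ be the partition of $G$ into the equivalence classes of the relation $$g\sim h \iff \sigma_X(g)=\sigma_X(h)\ \text{ for all } X\in\mathcal{X}.$$ For a set $\mathcal{K}$ of subsets of $G$, each of which is a union of conjugacy classes, let $\operatorname{Irpt}(\mathcal{K})$ be the partition of $\operatorname{Irr}G$ into the equivalence classes of the relation $$\chi\sim\psi \iff \frac{\chi(\hat K)}{\chi(1)}=\frac{\psi(\hat K)}{\psi(1)}\ \text{ for all } K\in\mathcal{K}.$$ A partition of $G$ is called $G$-invariant if each of its members is a union of conjugacy classes of $G$. **Theorem.** Let $\mathcal{K}$ be a $G$-invariant partition of $G$. Then the following are equivalent: (a) $|\mathcal{K}|=|\operatorname{Irpt}(\mathcal{K})|$; (b) the linear span in $\mathbb{C}G$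 of the sums $\hat K$, $K\in\mathcal{K}$, is a unital subalgebra of the center $Z(\mathbb{C}G)$; (c) $\mathcal{K}=\operatorname{Clpt}(\operatorname{Irpt}(\mathcal{K}))$. -/

import Mathlib

open scoped MonoidAlgebra

namespace Supercharacter

/-- `Irr G`, the irreducible complex characters of `G`: the functions `G → ℂ` afforded by
irreducible representations on finite-dimensional complex vector spaces (without loss of
generality on some `ℂⁿ`, see `character_mem_Irr`). -/
def Irr (G : Type*) [Group G] : Set (G → ℂ) :=
  {χ | ∃ (n : ℕ) (ρ : Representation ℂ G (Fin n → ℂ)), ρ.IsIrreducible ∧ ρ.character = χ}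

/-- The character of every finite-dimensional irreducible representation lies in `Irr G`. -/
theorem character_mem_Irr {G V : Type*} [Group G] [AddCommGroup V] [Module ℂ V]
    [FiniteDimensional ℂ V] (ρ : Representation ℂ G V) (hρ : ρ.IsIrreducible) :
    ρ.character ∈ Irr G := by
  let e : V ≃ₗ[ℂ] (Fin (Module.finrank ℂ V) → ℂ) :=
    LinearEquiv.ofFinrankEq V _ (by simp)
  let σ : Representation ℂ G (Fin (Module.finrank ℂ V) → ℂ) :=
    { toFun := fun g => e.conj (ρ g)
      map_one' := by ext; simp
      map_mul' := fun g h => by ext; simp [LinearEquiv.conj_apply] }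
  have hσ : ∀ g v, σ g v = e (ρ g (e.symm v)) := fun g v => rfl
  refine ⟨_, σ, ?_, ?_⟩
  · let f : Subrepresentation σ ≃o Subrepresentation ρ :=
      { toFun := fun U => ⟨U.toSubmodule.comap e.toLinearMap, fun g v hv => by
          have := U.apply_mem_toSubmodule g hv
          simpa [hσ] using this⟩
        invFun := fun U => ⟨U.toSubmodule.comap e.symm.toLinearMap, fun g v hv => by
          have := U.apply_mem_toSubmodule g hv
          simpa [hσ] using this⟩
        left_inv := fun U => by
          apply Subrepresentation.toSubmodule_injective
          ext; simp
        right_inv := fun U => by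
          apply Subrepresentation.toSubmodule_injective
          ext; simp
        map_rel_iff' := by
          intro U W
          constructor
          · intro h v hv
            have := @h (e.symm v) (by change e (e.symm v) ∈ U; simpa using hv)
            change e (e.symm v) ∈ W at this
            simpa using this
          · intro h v hv
            exact @h (e v) hv }
    exact f.isSimpleOrder_iff.2 hρ
  · ext g
    exact LinearMap.trace_conj' (ρ g) e

/-- A finite group has only finitely many irreducible characters. -/
instance finite_Irr (G : Type*) [Group G] [Finite G] : Finite (Irr G) := by
  classical
  have := Fintype.ofFinite G
  have hc : (Nat.card G : ℂ) ≠ 0 := by simp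
  have : Invertible (Nat.card G : ℂ) := invertibleOfNonzero hc
  have horth : ∀ χ ψ : Irr G, (Nat.card G : ℂ)⁻¹ * ∑ g : G, χ.1 g * ψ.1 g⁻¹ =
      if χ = ψ then 1 else 0 := by
    rintro ⟨χ, n, ρ, hρ, rfl⟩ ⟨ψ, m, σ, hσ, rfl⟩
    have h := Representation.char_orthonormal ρ σ
    split_ifs with e
    · have e' : ρ.character = σ.character := congrArg Subtype.val e
      have h' := Representation.char_orthonormal ρ ρ
      rw [if_pos ⟨Representation.Equiv.refl ρ⟩] at h'
      change (Nat.card G : ℂ)⁻¹ * ∑ g : G, ρ.character g * σ.character g⁻¹ = 1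
      rw [← e', h']
    · rw [h, if_neg]
      rintro ⟨φ⟩
      exact e (Subtype.ext (Representation.char_iso φ).symm)
  have hli : LinearIndependent ℂ (fun χ : Irr G => χ.1) := by
    rw [linearIndependent_iff']
    intro s c hs ψ hψ
    have h0 : ∑ χ ∈ s, c χ * ((Nat.card G : ℂ)⁻¹ * ∑ g : G, χ.1 g * ψ.1 g⁻¹) = 0 := by
      have : ∀ g : G, ∑ χ ∈ s, c χ * χ.1 g = 0 := fun g => by
        simpa using congrFun hs g
      calc _ = (Nat.card G : ℂ)⁻¹ * ∑ g : G, (∑ χ ∈ s, c χ * χ.1 g) * ψ.1 g⁻¹ := by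
            simp only [Finset.mul_sum, Finset.sum_mul]
            rw [Finset.sum_comm]
            refine Finset.sum_congr rfl fun _ _ => Finset.sum_congr rfl fun _ _ => by ring
        _ = 0 := by simp [this]
    simp_rw [horth] at h0
    simpa [hψ] using h0
  exact hli.finite

/-- `S` is a normal subset of `G`, that is, a union of conjugacy classes. -/
def IsNormalSubset {G : Type*} [Group G] (S : Set G) : Prop :=
  ∀ x ∈ S, ∀ g : G, g * x * g⁻¹ ∈ S

/-- A `G`-invariant partition of `G`: a partition all of whose members are normal subsets. -/
def IsInvariantPartition {G : Type*} [Group G] (𝒦 : Set (Set G)) : Prop :=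
  Setoid.IsPartition 𝒦 ∧ ∀ K ∈ 𝒦, IsNormalSubset K

section

variable {G : Type*} [Group G] [Finite G]

/-- The sum `K̂ = ∑_{g ∈ K} g` in the group algebra `ℂ[G]`. -/
noncomputable def hat (K : Set G) : ℂ[G] :=
  ∑ g ∈ (Set.toFinite K).toFinset, MonoidAlgebra.single g 1

/-- The class function `σ_X = ∑_{χ ∈ X} χ(1) χ`. -/
noncomputable def sigma (X : Set (Irr G)) (g : G) : ℂ :=
  ∑ χ ∈ (Set.toFinite X).toFinset, χ.1 1 * χ.1 g

/-- The value `χ(z)` at `z ∈ ℂ[G]` of the linear extension of `χ : G → ℂ`. -/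
noncomputable def linExt (χ : G → ℂ) (z : ℂ[G]) : ℂ :=
  z.coeff.sum fun g a => a * χ g

/-- `Clpt 𝒳`: the partition of `G` into the equivalence classes of
`g ∼ h ↔ ∀ X ∈ 𝒳, σ_X(g) = σ_X(h)`. -/
def Clpt (𝒳 : Set (Set (Irr G))) : Set (Set G) :=
  Setoid.classes
    { r := fun g h => ∀ X ∈ 𝒳, sigma X g = sigma X h
      iseqv := ⟨fun _ _ _ => rfl, fun H X hX => (H X hX).symm,
        fun H₁ H₂ X hX => (H₁ X hX).trans (H₂ X hX)⟩ }

/-- `Irpt 𝒦`: the partition of `Irr G` into the equivalence classes of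
`χ ∼ ψ ↔ ∀ K ∈ 𝒦, χ(K̂) / χ(1) = ψ(K̂) / ψ(1)`. -/
def Irpt (𝒦 : Set (Set G)) : Set (Set (Irr G)) :=
  Setoid.classes
    { r := fun χ ψ => ∀ K ∈ 𝒦, linExt χ.1 (hat K) / χ.1 1 = linExt ψ.1 (hat K) / ψ.1 1
      iseqv := ⟨fun _ _ _ => rfl, fun H K hK => (H K hK).symm,
        fun H₁ H₂ K hK => (H₁ K hK).trans (H₂ K hK)⟩ }

end

end Supercharacter

/-! By Schur's lemma a central element `z` acts on a representation affording `χ` as the scalar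
`omega z χ`. Hence `omega` is multiplicative on the centre, and it is injective there because `ℂ[G]`
is a sum of simple modules (Maschke).

Let `V` be the span of the sums `hat K`, `K ∈ 𝒦`. It is central since `𝒦` is invariant, and by the
definition of `Irpt` its image under `omega` consists of functions constant on the members of `Irpt
𝒦`. Each of the three conditions says that this inclusion is an equality.

(a) The two spaces have dimensions `|𝒦|` and `|Irpt 𝒦|`. (b) If `V` is a unital algebra, so is its
image, and it separates the members of `Irpt 𝒦`; `blockFunctions_le_of_separates` then gives
everything. Conversely, the block functions form a unital algebra, which pulls back through `omega`.
(c) The indicator of `X` is `omega (idem X)`, and the coefficients of `idem X` are the conjugates of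
the values of `sigma X`, up to a common factor. Equality therefore means that `V` is spanned by the
`idem X`, `X ∈ Irpt 𝒦`. -/

namespace Supercharacter

/-! ### Functions constant on the members of a partition -/

section BlockFunctions

variable {α : Type*}

/-- The complex functions which are constant on each member of `𝒟`. -/
def blockFunctions (𝒟 : Set (Set α)) : Submodule ℂ (α → ℂ) where
  carrier := {f | ∀ P ∈ 𝒟, ∀ a ∈ P, ∀ b ∈ P, f a = f b}
  add_mem' hf hg P hP a ha b hb := by simp [hf P hP a ha b hb, hg P hP a ha b hb]
  zero_mem' _ _ _ _ _ _ := rfl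
  smul_mem' c f hf P hP a ha b hb := by simp [hf P hP a ha b hb]

/-- Two members of a partition with a common point are equal. -/
theorem eq_of_mem_of_mem {𝒟 : Set (Set α)} (h𝒟 : Setoid.IsPartition 𝒟) {P Q : Set α}
    (hP : P ∈ 𝒟) (hQ : Q ∈ 𝒟) {a : α} (haP : a ∈ P) (haQ : a ∈ Q) : P = Q :=
  (h𝒟.2 a).unique ⟨hP, haP⟩ ⟨hQ, haQ⟩

theorem indicator_mem_blockFunctions {𝒟 : Set (Set α)} (h𝒟 : Setoid.IsPartition 𝒟)
    {P : Set α} (hP : P ∈ 𝒟) : P.indicator (1 : α → ℂ) ∈ blockFunctions 𝒟 := by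
  classical
  intro Q hQ a ha b hb
  have key : a ∈ P ↔ b ∈ P :=
    ⟨fun h => eq_of_mem_of_mem h𝒟 hQ hP ha h ▸ hb, fun h => eq_of_mem_of_mem h𝒟 hQ hP hb h ▸ ha⟩
  simp [Set.indicator_apply, key]

variable [Finite α]

theorem blockFunctions_eq_span {𝒟 : Set (Set α)} (h𝒟 : Setoid.IsPartition 𝒟) :
    blockFunctions 𝒟 = Submodule.span ℂ ((fun P => P.indicator (1 : α → ℂ)) '' 𝒟) := by
  classical
  apply le_antisymm
  · intro f hf
    cases isEmpty_or_nonempty α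
    · rw [Subsingleton.elim f 0]
      exact zero_mem _
    choose! rep hrep using fun P hP => Setoid.nonempty_of_mem_partition h𝒟 (s := P) hP
    have hsum : f = ∑ P ∈ (Set.toFinite 𝒟).toFinset, f (rep P) • P.indicator (1 : α → ℂ) := by
      ext a
      obtain ⟨P, ⟨hP, haP⟩, -⟩ := h𝒟.2 a
      rw [Finset.sum_apply, Finset.sum_eq_single P]
      · simp [haP, hf P hP a haP _ (hrep P hP)]
      · intro Q hQ hne
        have : a ∉ Q := fun h =>
          hne (eq_of_mem_of_mem h𝒟 ((Set.Finite.mem_toFinset _).1 hQ) hP h haP)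
        simp [this]
      · simp [hP]
    rw [hsum]
    exact Submodule.sum_mem _ fun P hP => Submodule.smul_mem _ _
      (Submodule.subset_span ⟨P, (Set.Finite.mem_toFinset _).1 hP, rfl⟩)
  · rw [Submodule.span_le]
    rintro _ ⟨P, hP, rfl⟩
    exact indicator_mem_blockFunctions h𝒟 hP

theorem finrank_blockFunctions {𝒟 : Set (Set α)} (h𝒟 : Setoid.IsPartition 𝒟) :
    Module.finrank ℂ (blockFunctions 𝒟) = 𝒟.ncard := by
  classical
  have := Fintype.ofFinite 𝒟
  have hli : LinearIndependent ℂ (fun P : 𝒟 => P.1.indicator (1 : α → ℂ)) := by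
    rw [Fintype.linearIndependent_iff]
    intro c hc P
    obtain ⟨a, ha⟩ := Setoid.nonempty_of_mem_partition h𝒟 P.2
    have h := congrFun hc a
    rw [Finset.sum_apply, Finset.sum_eq_single P] at h
    · simpa [ha] using h
    · intro Q _ hne
      have : a ∉ Q.1 := fun h => hne (Subtype.ext (eq_of_mem_of_mem h𝒟 Q.2 P.2 h ha))
      simp [this]
    · simp
  rw [blockFunctions_eq_span h𝒟, Set.image_eq_range, finrank_span_eq_card hli,
    ← Nat.card_eq_fintype_card, Nat.card_coe_set_eq]

/-- A unital algebra of functions on a finite set contains every function which is constant on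
the members of a partition, provided it separates the points of different members. -/
theorem blockFunctions_le_of_separates {𝒟 : Set (Set α)} (h𝒟 : Setoid.IsPartition 𝒟)
    (A : Subalgebra ℂ (α → ℂ))
    (hconst : Subalgebra.toSubmodule A ≤ blockFunctions 𝒟)
    (hsep : ∀ P ∈ 𝒟, ∀ a ∈ P, ∀ b ∉ P, ∃ f ∈ A, f a ≠ f b) :
    blockFunctions 𝒟 ≤ Subalgebra.toSubmodule A := by
  classical
  have := Fintype.ofFinite α
  rw [blockFunctions_eq_span h𝒟, Submodule.span_le]
  rintro _ ⟨P, hP, rfl⟩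
  obtain ⟨a, ha⟩ := Setoid.nonempty_of_mem_partition h𝒟 hP
  choose! f hfA hf using hsep P hP a ha
  -- `u b` is normalised to be 1 on `P` and 0 at `b`, so the product over all `b ∉ P` is the
  -- indicator of `P`.
  let u : α → α → ℂ := fun b => (f b a - f b b)⁻¹ • (f b - algebraMap ℂ (α → ℂ) (f b b))
  have hu : ∀ b ∉ P, u b ∈ A := fun b hb =>
    A.smul_mem (A.sub_mem (hfA b hb) (A.algebraMap_mem _)) _
  have hprod : P.indicator (1 : α → ℂ) = ∏ b ∈ Finset.univ.filter (· ∉ P), u b := by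
    ext x
    rw [Finset.prod_apply]
    by_cases hx : x ∈ P
    · rw [Set.indicator_of_mem hx, Finset.prod_eq_one]
      · rfl
      · intro b hb
        have hb : b ∉ P := by simpa using hb
        have hxa : f b x = f b a := hconst (hfA b hb) P hP x hx a ha
        simp [u, hxa, inv_mul_cancel₀ (sub_ne_zero.2 (hf b hb))]
    · rw [Set.indicator_of_notMem hx]
      exact (Finset.prod_eq_zero (i := x) (by simpa using hx) (by simp [u])).symm
  change P.indicator (1 : α → ℂ) ∈ A
  rw [hprod]
  exact A.prod_mem fun b hb => hu b (by simpa using hb)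

end BlockFunctions

/-! ### Irreducible characters -/

section Characters

variable {G : Type*} [Group G]

theorem Irr_conj (χ : Irr G) (g h : G) : χ.1 (h * g * h⁻¹) = χ.1 g := by
  obtain ⟨χ, n, ρ, hρ, rfl⟩ := χ
  exact Representation.char_conj ρ g h

theorem Irr_one_ne_zero (χ : Irr G) : χ.1 1 ≠ 0 := by
  obtain ⟨χ, n, ρ, hρ, rfl⟩ := χ
  change ρ.character 1 ≠ 0
  rw [Representation.char_one]
  have : Nontrivial (Fin n → ℂ) := by
    by_contra h
    rw [not_nontrivial_iff_subsingleton] at h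
    obtain ⟨U, W, hUW⟩ := hρ.toNontrivial
    refine hUW (Subrepresentation.toSubmodule_injective ?_)
    exact Subsingleton.elim _ _
  exact_mod_cast (Module.finrank_pos (R := ℂ) (M := Fin n → ℂ)).ne'

theorem Irr_orthonormal [Fintype G] [DecidableEq (Irr G)] (χ ψ : Irr G) :
    (Nat.card G : ℂ)⁻¹ * ∑ g : G, χ.1 g * ψ.1 g⁻¹ = if χ = ψ then 1 else 0 := by
  have : Invertible (Nat.card G : ℂ) := invertibleOfNonzero (by simp)
  obtain ⟨χ, n, ρ, hρ, rfl⟩ := χ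
  obtain ⟨ψ, m, σ, hσ, rfl⟩ := ψ
  split_ifs with e
  -- No isomorphism between `ρ` and `σ` is at hand here, but equal characters allow `ρ` to be paired
  -- with itself.
  · have e' : ρ.character = σ.character := congrArg Subtype.val e
    have h := Representation.char_orthonormal ρ ρ
    rw [if_pos ⟨Representation.Equiv.refl ρ⟩] at h
    change (Nat.card G : ℂ)⁻¹ * ∑ g : G, ρ.character g * σ.character g⁻¹ = 1
    rw [← e', h]
  · have h := Representation.char_orthonormal ρ σ
    rw [if_neg] at h
    · exact h
    · rintro ⟨φ⟩
      exact e (Subtype.ext (Representation.char_iso φ).symm)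

variable [Finite G]

open Matrix in
/-- If the matrices `M g` form a representation of a finite group, then the trace of `M g⁻¹` is
the complex conjugate of that of `M g`. -/
theorem trace_map_inv {ι : Type*} [Fintype ι] [DecidableEq ι] (M : G →* Matrix ι ι ℂ) (g : G) :
    (M g⁻¹).trace = star (M g).trace := by
  have := Fintype.ofFinite G
  classical
  -- The Gram matrix of the standard Hermitian form summed over the group. It is invariant, and
  -- invertible because the summand at 1 is positive definite and the others are semidefinite. Hence
  -- `(M g)ᴴ` is conjugate to `M g⁻¹` by `P`.
  open scoped ComplexOrder in
  let P : Matrix ι ι ℂ := ∑ h : G, (M h)ᴴ * M h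
  have hP : IsUnit P := by
    have h1 : P = 1 + ∑ h ∈ Finset.univ.erase (1 : G), (M h)ᴴ * M h := by
      change ∑ h : G, (M h)ᴴ * M h = _
      rw [← Finset.add_sum_erase _ _ (Finset.mem_univ (1 : G))]
      simp
    rw [h1]
    exact (PosDef.one.add_posSemidef
      (posSemidef_sum _ fun h _ => posSemidef_conjTranspose_mul_self (M h))).isUnit
  have hinv : (M g)ᴴ * P * M g = P := by
    simp only [P, Finset.mul_sum, Finset.sum_mul]
    rw [← Equiv.sum_comp (Equiv.mulRight g) (fun h => (M h)ᴴ * M h)]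
    simp [Matrix.mul_assoc, conjTranspose_mul]
  have hcomm : (M g)ᴴ * P = P * M g⁻¹ := by
    calc (M g)ᴴ * P = (M g)ᴴ * P * M g * M g⁻¹ := by
          rw [Matrix.mul_assoc _ (M g), ← map_mul, mul_inv_cancel, map_one, mul_one]
      _ = P * M g⁻¹ := by rw [hinv]
  have hdet : IsUnit P.det := (isUnit_iff_isUnit_det _).1 hP
  rw [← trace_conjTranspose]
  calc (M g⁻¹).trace = (P⁻¹ * (P * M g⁻¹)).trace := by
        rw [← Matrix.mul_assoc, nonsing_inv_mul _ hdet, one_mul]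
    _ = ((M g)ᴴ).trace := by
        rw [← hcomm, trace_mul_comm, Matrix.mul_assoc, mul_nonsing_inv _ hdet, mul_one]

theorem Irr_inv (χ : Irr G) (g : G) : χ.1 g⁻¹ = star (χ.1 g) := by
  obtain ⟨χ, n, ρ, hρ, rfl⟩ := χ
  let M : G →* Matrix (Fin n) (Fin n) ℂ :=
    MonoidHom.comp (LinearMap.toMatrixAlgEquiv' : _ ≃ₐ[ℂ] _).toAlgHom.toMonoidHom ρ
  have ht : ∀ x, ρ.character x = (M x).trace := fun x =>
    LinearMap.trace_eq_matrix_trace ℂ (Pi.basisFun ℂ (Fin n)) (ρ x)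
  change ρ.character g⁻¹ = star (ρ.character g)
  rw [ht, ht, trace_map_inv]

end Characters

/-! ### Central characters -/

section CentralCharacters

variable {G : Type*}

theorem linExt_eq_sum [Fintype G] (χ : G → ℂ) (z : ℂ[G]) :
    linExt χ z = ∑ g, z.coeff g * χ g :=
  Finsupp.sum_fintype _ _ (by simp)

variable [Group G]

theorem trace_asAlgebraHom {V : Type*} [AddCommGroup V] [Module ℂ V]
    (ρ : Representation ℂ G V) (z : ℂ[G]) :
    LinearMap.trace ℂ V (ρ.asAlgebraHom z) = linExt ρ.character z := by
  rw [Representation.asAlgebraHom_def, MonoidAlgebra.lift_apply, Finsupp.sum, map_sum]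
  simp [linExt, Finsupp.sum, Representation.character]

theorem mem_center_of_coeff_conj {z : ℂ[G]} (hz : ∀ g h : G, z.coeff (h * g * h⁻¹) = z.coeff g) :
    z ∈ Subalgebra.center ℂ ℂ[G] := by
  rw [Subalgebra.mem_center_iff]
  intro b
  induction b using MonoidAlgebra.induction_linear with
  | zero => simp
  | add f g hf hg => rw [add_mul, mul_add, hf, hg]
  | single h c =>
    ext g
    rw [MonoidAlgebra.coeff_single_mul_eq_mul_coeff (h⁻¹ * g) (by simp [eq_inv_mul_iff_mul_eq]),
      MonoidAlgebra.coeff_mul_single_eq_coeff_mul (g * h⁻¹) (by simp [eq_mul_inv_iff_mul_eq]),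
      ← hz (h⁻¹ * g) h, mul_comm]
    simp

/-- Schur's lemma: a central element acts on an irreducible representation by its central
character. -/
theorem asAlgebraHom_eq_algebraMap {V : Type*} [AddCommGroup V] [Module ℂ V]
    [FiniteDimensional ℂ V] (ρ : Representation ℂ G V) [ρ.IsIrreducible] {z : ℂ[G]}
    (hz : z ∈ Subalgebra.center ℂ ℂ[G]) (h1 : ρ.character 1 ≠ 0) :
    ρ.asAlgebraHom z = algebraMap ℂ _ (linExt ρ.character z / ρ.character 1) := by
  obtain ⟨c, hc⟩ :=
    (Representation.IsIrreducible.algebraMap_intertwiningMap_bijective_of_isAlgClosed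
      (ρ := ρ)).2 (Representation.IntertwiningMap.centralAlgebraMul ρ (z := z) hz)
  have hc' : ρ.asAlgebraHom z = algebraMap ℂ (Module.End ℂ V) c := by
    ext v
    have := DFunLike.congr_fun hc v
    rw [Representation.IntertwiningMap.algebraMap_apply] at this
    exact this.symm
  -- Taking traces identifies the scalar: the trace is `c` times the degree.
  rw [hc', ← trace_asAlgebraHom, hc']
  congr 1
  rw [Representation.char_one] at h1 ⊢
  rw [Algebra.algebraMap_eq_smul_one, map_smul, LinearMap.trace_one, smul_eq_mul,
    mul_div_cancel_right₀ _ h1]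

theorem asAlgebraHom_ofModule' (M : Type*) [AddCommGroup M] [Module ℂ M] [Module ℂ[G] M]
    [IsScalarTower ℂ ℂ[G] M] :
    (Representation.ofModule' (k := ℂ) (G := G) M).asAlgebraHom = Algebra.lsmul ℂ ℂ M :=
  (MonoidAlgebra.lift ℂ (M →ₗ[ℂ] M) G).apply_symm_apply _

/-- Passing to `ofModule'` and back to `asModule` recovers `M` with its original action, so
simplicity carries over. -/
theorem isIrreducible_ofModule' (M : Type*) [AddCommGroup M] [Module ℂ M] [Module ℂ[G] M]
    [IsScalarTower ℂ ℂ[G] M] [IsSimpleModule ℂ[G] M] :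
    (Representation.ofModule' (k := ℂ) (G := G) M).IsIrreducible := by
  rw [Representation.irreducible_iff_isSimpleModule_asModule]
  let ρ := Representation.ofModule' (k := ℂ) (G := G) M
  let e : ρ.asModule ≃ₗ[ℂ[G]] M :=
    { ρ.asModuleEquiv.toAddEquiv with
      map_smul' := fun r x => by
        change ρ.asModuleEquiv (r • x) = r • ρ.asModuleEquiv x
        rw [Representation.asModuleEquiv_map_smul, asAlgebraHom_ofModule']
        rfl }
  exact IsSimpleModule.congr e

variable [Finite G]

/-- The linear map sending `z` to the function `χ ↦ χ(z) / χ(1)` on `Irr G`. -/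
noncomputable def omega : ℂ[G] →ₗ[ℂ] (Irr G → ℂ) where
  toFun z χ := linExt χ.1 z / χ.1 1
  map_add' z w := by
    have := Fintype.ofFinite G
    ext χ
    simp [linExt_eq_sum, add_mul, Finset.sum_add_distrib, add_div]
  map_smul' c z := by
    have := Fintype.ofFinite G
    ext χ
    simp [linExt_eq_sum, ← Finset.mul_sum, mul_assoc, mul_div_assoc]

theorem omega_apply (z : ℂ[G]) (χ : Irr G) : omega z χ = linExt χ.1 z / χ.1 1 := rfl

theorem omega_one : omega (1 : ℂ[G]) = 1 := by
  ext χ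
  rw [omega_apply, Pi.one_apply, div_eq_one_iff_eq (Irr_one_ne_zero χ), MonoidAlgebra.one_def]
  simp [linExt]

/-- Central elements act as scalars on irreducibles, and scalars of a product multiply; the trace
then yields the identity times `χ(1)`, which cancels. -/
theorem omega_mul {z w : ℂ[G]} (hz : z ∈ Subalgebra.center ℂ ℂ[G])
    (hw : w ∈ Subalgebra.center ℂ ℂ[G]) : omega (z * w) = omega z * omega w := by
  ext χ
  have h1 := Irr_one_ne_zero χ
  obtain ⟨χ, n, ρ, hρ, rfl⟩ := χ
  have h := map_mul ρ.asAlgebraHom z w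
  rw [asAlgebraHom_eq_algebraMap ρ hz h1, asAlgebraHom_eq_algebraMap ρ hw h1,
    asAlgebraHom_eq_algebraMap ρ (mul_mem hz hw) h1, ← map_mul] at h
  have := congrArg (LinearMap.trace ℂ _) h
  rw [Algebra.algebraMap_eq_smul_one, Algebra.algebraMap_eq_smul_one, map_smul, map_smul,
    LinearMap.trace_one, ← Representation.char_one ρ] at this
  exact mul_right_cancel₀ h1 this

/-- A central element at which all central characters vanish annihilates all simple modules. -/
theorem smul_eq_zero_of_omega_eq_zero (M : Type*) [AddCommGroup M] [Module ℂ M] [Module ℂ[G] M]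
    [IsScalarTower ℂ ℂ[G] M] [FiniteDimensional ℂ M] [IsSimpleModule ℂ[G] M] {z : ℂ[G]}
    (hz : z ∈ Subalgebra.center ℂ ℂ[G]) (h : omega z = 0) (m : M) : z • m = 0 := by
  have hirr := isIrreducible_ofModule' (G := G) M
  let χ : Irr G := ⟨_, character_mem_Irr _ hirr⟩
  have hact := asAlgebraHom_eq_algebraMap _ hz (Irr_one_ne_zero χ)
  have hχ : linExt (Representation.ofModule' (k := ℂ) (G := G) M).character z /
    (Representation.ofModule' (k := ℂ) (G := G) M).character 1 = 0 := congrFun h χ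
  rw [hχ, map_zero, asAlgebraHom_ofModule'] at hact
  exact LinearMap.congr_fun hact m

/-- The central characters jointly separate the central elements. -/
theorem eq_zero_of_omega_eq_zero {z : ℂ[G]} (hz : z ∈ Subalgebra.center ℂ ℂ[G])
    (h : omega z = 0) : z = 0 := by
  have hmem : ∀ y ∈ (⊤ : Submodule ℂ[G] ℂ[G]), z * y = 0 := by
    -- The annihilator of `z` is a left ideal because `z` is central. It contains every simple left
    -- ideal, and by Maschke these generate `ℂ[G]`.
    let N : Submodule ℂ[G] ℂ[G] :=
      { carrier := {y | z * y = 0}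
        add_mem' := fun {a b} ha hb => by
          change z * (a + b) = 0
          rw [mul_add, show z * a = 0 from ha, show z * b = 0 from hb, add_zero]
        zero_mem' := mul_zero z
        smul_mem' := fun c y hy => by
          change z * (c * y) = 0
          rw [← mul_assoc, ← Subalgebra.mem_center_iff.1 hz c, mul_assoc,
            show z * y = 0 from hy, mul_zero] }
    have : NeZero (Nat.card G : ℂ) := ⟨Nat.cast_ne_zero.2 Nat.card_pos.ne'⟩
    rw [← IsSemisimpleModule.sSup_simples_eq_top ℂ[G] ℂ[G]]
    suffices hN : sSup {m : Submodule ℂ[G] ℂ[G] | IsSimpleModule ℂ[G] m} ≤ N from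
      fun y hy => hN hy
    refine sSup_le fun S hS y hy => ?_
    have hS : IsSimpleModule ℂ[G] S := hS
    have : FiniteDimensional ℂ ℂ[G] :=
      Module.Finite.equiv (MonoidAlgebra.coeffLinearEquiv (S := ℂ) (M := G) ℂ).symm
    have : FiniteDimensional ℂ S := inferInstanceAs (FiniteDimensional ℂ (S.restrictScalars ℂ))
    exact congrArg Subtype.val (smul_eq_zero_of_omega_eq_zero S hz h ⟨y, hy⟩)
  simpa using hmem 1 trivial

theorem eq_of_omega_eq {z w : ℂ[G]} (hz : z ∈ Subalgebra.center ℂ ℂ[G])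
    (hw : w ∈ Subalgebra.center ℂ ℂ[G]) (h : omega z = omega w) : z = w :=
  sub_eq_zero.1 (eq_zero_of_omega_eq_zero (sub_mem hz hw) (by rw [map_sub, h, sub_self]))

/-! ### Central idempotents attached to sets of characters -/

theorem sigma_inv (X : Set (Irr G)) (g : G) : sigma X g⁻¹ = star (sigma X g) := by
  have h1 : ∀ χ : Irr G, star (χ.1 1) = χ.1 1 := fun χ => by rw [← Irr_inv, inv_one]
  simp only [sigma, star_sum, star_mul', h1, Irr_inv]

theorem sigma_conj (X : Set (Irr G)) (g h : G) : sigma X (h * g * h⁻¹) = sigma X g := by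
  simp only [sigma, Irr_conj]

/-- The central idempotent `∑_{χ ∈ X} e_χ`, where `e_χ` is the primitive central idempotent
belonging to `χ`. -/
noncomputable def idem (X : Set (Irr G)) : ℂ[G] :=
  MonoidAlgebra.ofCoeff
    (Finsupp.equivFunOnFinite.symm fun g => (Nat.card G : ℂ)⁻¹ * sigma X g⁻¹)

theorem coeff_idem (X : Set (Irr G)) (g : G) :
    (idem X).coeff g = (Nat.card G : ℂ)⁻¹ * star (sigma X g) := by
  rw [← sigma_inv]; rfl

/-- The coefficient of `idem X` at `g` involves `sigma X g⁻¹`, whereas `Clpt` compares values at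
`g`; complex conjugation removes the discrepancy. -/
theorem coeff_idem_eq_iff (X : Set (Irr G)) (g h : G) :
    (idem X).coeff g = (idem X).coeff h ↔ sigma X g = sigma X h := by
  rw [coeff_idem, coeff_idem, mul_right_inj' (inv_ne_zero (Nat.cast_ne_zero.2 Nat.card_pos.ne')), star_inj]

theorem idem_mem_center (X : Set (Irr G)) : idem X ∈ Subalgebra.center ℂ ℂ[G] :=
  mem_center_of_coeff_conj fun g h => by rw [coeff_idem_eq_iff, sigma_conj]

/-- Orthogonality leaves only the term `χ = ψ`, whose factor `ψ(1)` cancels the denominator. -/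
theorem omega_idem (X : Set (Irr G)) : omega (idem X) = X.indicator 1 := by
  classical
  have := Fintype.ofFinite G
  ext ψ
  have key : linExt ψ.1 (idem X) =
      ∑ χ ∈ (Set.toFinite X).toFinset, χ.1 1 * if ψ = χ then 1 else 0 := by
    simp_rw [← Irr_orthonormal, linExt_eq_sum, coeff_idem, ← sigma_inv, sigma, Finset.mul_sum,
      Finset.sum_mul]
    rw [Finset.sum_comm]
    exact Finset.sum_congr rfl fun _ _ => Finset.sum_congr rfl fun _ _ => by ring
  rw [omega_apply, key]
  by_cases hψ : ψ ∈ X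
  · simp [hψ, Irr_one_ne_zero ψ]
  · simp [hψ]

end CentralCharacters

/-! ### Spans of sums over the members of a partition -/

section Main

variable {G : Type*} [Finite G]

theorem coeff_hat (K : Set G) (g : G) : (hat K).coeff g = K.indicator 1 g := by
  classical
  rw [hat, MonoidAlgebra.coeff_sum, Finsupp.finsetSum_apply]
  simp [Finsupp.single_apply, Set.indicator_apply]

/-- The identification of the group algebra of a finite group with the functions on the group. -/
noncomputable def coeffEquivFun (G : Type*) [Finite G] : ℂ[G] ≃ₗ[ℂ] (G → ℂ) :=
  (MonoidAlgebra.coeffLinearEquiv ℂ).trans (Finsupp.linearEquivFunOnFinite ℂ ℂ G)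

theorem map_span_hat {𝒦 : Set (Set G)} (h𝒦 : Setoid.IsPartition 𝒦) :
    (Submodule.span ℂ (hat '' 𝒦)).map (coeffEquivFun G : ℂ[G] →ₗ[ℂ] (G → ℂ)) =
      blockFunctions 𝒦 := by
  rw [Submodule.map_span, blockFunctions_eq_span h𝒦, ← Set.image_comp]
  congr 2
  ext K g
  exact coeff_hat K g

theorem mem_span_hat {𝒦 : Set (Set G)} (h𝒦 : Setoid.IsPartition 𝒦) {z : ℂ[G]} :
    z ∈ Submodule.span ℂ (hat '' 𝒦) ↔ ∀ K ∈ 𝒦, ∀ g ∈ K, ∀ h ∈ K, z.coeff g = z.coeff h := by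
  rw [← SetLike.mem_coe, ← (coeffEquivFun G).injective.mem_set_image]
  exact SetLike.ext_iff.1 (map_span_hat h𝒦) _

theorem finrank_span_hat {𝒦 : Set (Set G)} (h𝒦 : Setoid.IsPartition 𝒦) :
    Module.finrank ℂ (Submodule.span ℂ (hat '' 𝒦)) = 𝒦.ncard := by
  rw [← finrank_blockFunctions h𝒦, ← map_span_hat h𝒦]
  exact ((coeffEquivFun G).submoduleMap _).finrank_eq

variable [Group G]

theorem span_hat_le_center {𝒦 : Set (Set G)} (h𝒦 : IsInvariantPartition 𝒦) :
    Submodule.span ℂ (hat '' 𝒦) ≤ Subalgebra.toSubmodule (Subalgebra.center ℂ ℂ[G]) := by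
  intro z hz
  refine mem_center_of_coeff_conj fun g h => ?_
  obtain ⟨K, ⟨hK, hg⟩, -⟩ := h𝒦.1.2 g
  exact (mem_span_hat h𝒦.1).1 hz K hK _ (h𝒦.2 K hK g hg h) _ hg

theorem isPartition_Irpt (𝒦 : Set (Set G)) : Setoid.IsPartition (Irpt 𝒦) :=
  Setoid.isPartition_classes _

theorem exists_mem_Irpt_iff {𝒦 : Set (Set G)} {χ ψ : Irr G} :
    (∃ X ∈ Irpt 𝒦, χ ∈ X ∧ ψ ∈ X) ↔ ∀ K ∈ 𝒦, omega (hat K) χ = omega (hat K) ψ :=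
  (Setoid.rel_iff_exists_classes _).symm

theorem exists_mem_Clpt_iff {𝒳 : Set (Set (Irr G))} {g h : G} :
    (∃ K ∈ Clpt 𝒳, g ∈ K ∧ h ∈ K) ↔ ∀ X ∈ 𝒳, sigma X g = sigma X h :=
  (Setoid.rel_iff_exists_classes _).symm

theorem eq_Clpt_iff {𝒦 : Set (Set G)} (h𝒦 : Setoid.IsPartition 𝒦) {𝒳 : Set (Set (Irr G))} :
    𝒦 = Clpt 𝒳 ↔
      ∀ g h, (∃ K ∈ 𝒦, g ∈ K ∧ h ∈ K) ↔ ∀ X ∈ 𝒳, sigma X g = sigma X h := by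
  constructor
  · rintro e g h
    rw [e, exists_mem_Clpt_iff]
  · intro H
    rw [← Setoid.classes_mkClasses 𝒦 h𝒦, Clpt, ← Setoid.classes_inj]
    ext g h
    rw [Setoid.rel_iff_exists_classes, Setoid.classes_mkClasses 𝒦 h𝒦]
    exact H g h

/-! ### The three conditions as one equality of subspaces -/

theorem map_omega_le (𝒦 : Set (Set G)) :
    (Submodule.span ℂ (hat '' 𝒦)).map omega ≤ blockFunctions (Irpt 𝒦) := by
  rw [Submodule.map_span, Submodule.span_le]
  rintro _ ⟨_, ⟨K, hK, rfl⟩, rfl⟩ X hX χ hχ ψ hψ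
  exact exists_mem_Irpt_iff.1 ⟨X, hX, hχ, hψ⟩ K hK

theorem finrank_map_omega {𝒦 : Set (Set G)} (h𝒦 : IsInvariantPartition 𝒦) :
    Module.finrank ℂ ((Submodule.span ℂ (hat '' 𝒦)).map omega) = 𝒦.ncard := by
  have hinj : Function.Injective (omega.domRestrict (Submodule.span ℂ (hat '' 𝒦))) :=
    fun z w h => Subtype.ext
      (eq_of_omega_eq (span_hat_le_center h𝒦 z.2) (span_hat_le_center h𝒦 w.2) h)
  rw [← LinearMap.range_domRestrict, LinearMap.finrank_range_of_inj hinj,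
    finrank_span_hat h𝒦.1]

theorem encard_eq_encard_Irpt_iff {𝒦 : Set (Set G)} (h𝒦 : IsInvariantPartition 𝒦) :
    𝒦.encard = (Irpt 𝒦).encard ↔
      (Submodule.span ℂ (hat '' 𝒦)).map omega = blockFunctions (Irpt 𝒦) := by
  rw [← (Set.toFinite 𝒦).cast_ncard_eq, ← (Set.toFinite (Irpt 𝒦)).cast_ncard_eq, Nat.cast_inj,
    ← finrank_map_omega h𝒦, ← finrank_blockFunctions (isPartition_Irpt 𝒦)]
  exact ⟨Submodule.eq_of_le_of_finrank_eq (map_omega_le 𝒦), fun h => by rw [h]⟩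

theorem exists_subalgebra_iff {𝒦 : Set (Set G)} (h𝒦 : IsInvariantPartition 𝒦) :
    (∃ A : Subalgebra ℂ ℂ[G], A ≤ Subalgebra.center ℂ ℂ[G] ∧
        Subalgebra.toSubmodule A = Submodule.span ℂ (hat '' 𝒦)) ↔
      (Submodule.span ℂ (hat '' 𝒦)).map omega = blockFunctions (Irpt 𝒦) := by
  have hcenter := span_hat_le_center h𝒦
  constructor
  · rintro ⟨A, hA, hAspan⟩
    refine le_antisymm (map_omega_le 𝒦) ?_
    let B : Subalgebra ℂ (Irr G → ℂ) :=
      ((Submodule.span ℂ (hat '' 𝒦)).map omega).toSubalgebra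
        ⟨1, hAspan ▸ A.one_mem, omega_one⟩ (by
          rintro _ _ ⟨z, hz, rfl⟩ ⟨w, hw, rfl⟩
          refine ⟨z * w, ?_, omega_mul (hcenter hz) (hcenter hw)⟩
          rw [← hAspan] at hz hw ⊢
          exact A.mul_mem hz hw)
    refine blockFunctions_le_of_separates (isPartition_Irpt 𝒦) B (map_omega_le 𝒦) ?_
    intro X hX χ hχ ψ hψ
    by_contra! hcon
    obtain ⟨Y, hY, hχY, hψY⟩ := exists_mem_Irpt_iff.2 fun K hK =>
      hcon (omega (hat K)) ⟨_, Submodule.subset_span ⟨K, hK, rfl⟩, rfl⟩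
    rw [eq_of_mem_of_mem (isPartition_Irpt 𝒦) hX hY hχ hχY] at hψ
    exact hψ hψY
  · intro hmap
    -- Since `omega` is injective on the centre, membership of a central element in the span can be
    -- tested on its image.
    have hlift : ∀ z ∈ Subalgebra.center ℂ ℂ[G], omega z ∈ blockFunctions (Irpt 𝒦) →
        z ∈ Submodule.span ℂ (hat '' 𝒦) := by
      intro z hz hωz
      rw [← hmap] at hωz
      obtain ⟨w, hw, hwz⟩ := hωz
      rwa [← eq_of_omega_eq (hcenter hw) hz hwz]
    refine ⟨(Submodule.span ℂ (hat '' 𝒦)).toSubalgebra ?_ ?_, fun z hz => hcenter hz,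
      Submodule.toSubalgebra_toSubmodule _ _ _⟩
    · refine hlift 1 (one_mem _) ?_
      rw [omega_one]
      exact fun _ _ _ _ _ _ => rfl
    · intro z w hz hw
      refine hlift _ (mul_mem (hcenter hz) (hcenter hw)) ?_
      rw [omega_mul (hcenter hz) (hcenter hw)]
      have h1 := map_omega_le 𝒦 (Submodule.mem_map_of_mem hz)
      have h2 := map_omega_le 𝒦 (Submodule.mem_map_of_mem hw)
      intro X hX χ hχ ψ hψ
      rw [Pi.mul_apply, Pi.mul_apply, h1 X hX χ hχ ψ hψ, h2 X hX χ hχ ψ hψ]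

theorem idem_mem_span_hat_iff {𝒦 : Set (Set G)} (h𝒦 : Setoid.IsPartition 𝒦)
    {X : Set (Irr G)} : idem X ∈ Submodule.span ℂ (hat '' 𝒦) ↔
      ∀ K ∈ 𝒦, ∀ g ∈ K, ∀ h ∈ K, sigma X g = sigma X h := by
  simp_rw [mem_span_hat h𝒦, coeff_idem_eq_iff]

theorem eq_Clpt_Irpt_iff {𝒦 : Set (Set G)} (h𝒦 : IsInvariantPartition 𝒦) :
    𝒦 = Clpt (Irpt 𝒦) ↔
      (Submodule.span ℂ (hat '' 𝒦)).map omega = blockFunctions (Irpt 𝒦) := by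
  have hcenter := span_hat_le_center h𝒦
  have himage : blockFunctions (Irpt 𝒦) =
      (Submodule.span ℂ (idem '' Irpt 𝒦)).map omega := by
    rw [blockFunctions_eq_span (isPartition_Irpt 𝒦), Submodule.map_span, ← Set.image_comp]
    simp_rw [Function.comp_def, omega_idem]
  rw [eq_Clpt_iff h𝒦.1]
  constructor
  · intro H
    refine le_antisymm (map_omega_le 𝒦) ?_
    rw [himage]
    refine Submodule.map_mono (Submodule.span_le.2 ?_)
    rintro _ ⟨X, hX, rfl⟩
    exact (idem_mem_span_hat_iff h𝒦.1).2 fun K hK g hg h hh =>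
      (H g h).1 ⟨K, hK, hg, hh⟩ X hX
  · intro hmap g h
    have hidem_center : Submodule.span ℂ (idem '' Irpt 𝒦) ≤
        Subalgebra.toSubmodule (Subalgebra.center ℂ ℂ[G]) := by
      rw [Submodule.span_le]
      rintro _ ⟨X, -, rfl⟩
      exact idem_mem_center X
    -- Both spans are central and have the same image, so injectivity of `omega` on the centre makes
    -- them equal.
    have hspan : Submodule.span ℂ (hat '' 𝒦) = Submodule.span ℂ (idem '' Irpt 𝒦) := by
      rw [himage] at hmap
      apply le_antisymm
      · intro z hz
        obtain ⟨w, hw, hwz⟩ := hmap.le (Submodule.mem_map_of_mem hz)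
        rwa [← eq_of_omega_eq (hidem_center hw) (hcenter hz) hwz]
      · intro z hz
        obtain ⟨w, hw, hwz⟩ := hmap.ge (Submodule.mem_map_of_mem hz)
        rwa [← eq_of_omega_eq (hcenter hw) (hidem_center hz) hwz]
    constructor
    · rintro ⟨K, hK, hg, hh⟩ X hX
      exact (idem_mem_span_hat_iff h𝒦.1).1 (hspan ▸ Submodule.subset_span ⟨X, hX, rfl⟩)
        K hK g hg h hh
    · intro H
      -- Equality of the coefficients at `g` and `h` passes from the `idem X` to their whole span,
      -- hence to `hat K`, whose coefficients are the indicator of `K`.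
      have hcoeff : ∀ z ∈ Submodule.span ℂ (hat '' 𝒦), z.coeff g = z.coeff h := by
        rw [hspan]
        intro z hz
        induction hz using Submodule.span_induction with
        | mem z hz =>
          obtain ⟨X, hX, rfl⟩ := hz
          exact (coeff_idem_eq_iff X g h).2 (H X hX)
        | zero => simp
        | add z w _ _ hz hw => simp [hz, hw]
        | smul c z _ hz => simp [hz]
      obtain ⟨K, ⟨hK, hg⟩, -⟩ := h𝒦.1.2 g
      refine ⟨K, hK, hg, ?_⟩
      by_contra hh
      have := hcoeff (hat K) (Submodule.subset_span ⟨K, hK, rfl⟩)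
      simp [coeff_hat, hg, hh] at this

end Main

end Supercharacter

theorem mainTheorem4 {G : Type*} [Group G] [Finite G] (𝒦 : Set (Set G))
    (h𝒦 : Supercharacter.IsInvariantPartition 𝒦) :
    List.TFAE [
      𝒦.encard = (Supercharacter.Irpt 𝒦).encard,
      ∃ A : Subalgebra ℂ (MonoidAlgebra ℂ G),
        A ≤ Subalgebra.center ℂ (MonoidAlgebra ℂ G) ∧
        Subalgebra.toSubmodule A = Submodule.span ℂ (Supercharacter.hat '' 𝒦),
      𝒦 = Supercharacter.Clpt (Supercharacter.Irpt 𝒦)] := by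
  rw [Supercharacter.encard_eq_encard_Irpt_iff h𝒦, Supercharacter.exists_subalgebra_iff h𝒦,
    Supercharacter.eq_Clpt_Irpt_iff h𝒦]
  tfae_finish
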